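/- Theorem 1.1. For every integer $n \ge 1$ there is a constant $C = C(n)$ such that the following holds. Let $r > 0$, let $B_s \subset \mathbf{R}^n$ denote the open ball of radius $s$ centered at the origin, and let $u : B_{\sqrt{2n+1}\, r} \times [0, r^2] \to \mathbf{R}$ be a function whose graph flows by mean curvature, i.e. $u$ is continuous on $B_{\sqrt{2n+1}\, r} \times [0, r^2]$, smooth on $B_{\sqrt{2n+1}\, r} \times (0, r^2)$, and there satisfies $$u_t = (1 + |du|^2)^{1/2}\, \operatorname{div}\left( \frac{du}{(1 + |du|^2)^{1/2}} \right),$$ where $du$ is the gradient and $\operatorname{div}$ the divergence in the space variable $x \in \mathbf{R}^n$. Suppose that $\|u(\cdot,0)\|_\infty = \sup_{x \in B_{\sqrt{2n+1}\, r}} |u(x,0)|$ is finite. Then $$\log |du|\left(0, \tfrac{r^2}{4n}\right) \le C \left(1 + r^{-1} \|u(\cdot,0)\|_\infty\right)^2$$ (the left side is read as $-\infty$, so that nothing is claimed, if $du(0, r^2/(4n)) = 0$). -/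

import Mathlib

open scoped ContDiff

noncomputable section

/-- The Euclidean divergence `∑ i, ∂ᵢ Fᵢ` of a vector field on `ℝⁿ`. -/
def euclideanDiv {n : ℕ}
    (F : EuclideanSpace ℝ (Fin n) → EuclideanSpace ℝ (Fin n))
    (x : EuclideanSpace ℝ (Fin n)) : ℝ :=
  ∑ i : Fin n, (fderiv ℝ F x (EuclideanSpace.single i 1)) i

/-- `√(1 + |df|²) * div (df / √(1 + |df|²))`, the right-hand side of the mean curvature flow
equation for graphs. -/
def graphMeanCurvatureOp {n : ℕ} (f : EuclideanSpace ℝ (Fin n) → ℝ)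
    (x : EuclideanSpace ℝ (Fin n)) : ℝ :=
  Real.sqrt (1 + ‖gradient f x‖ ^ 2) *
    euclideanDiv (fun y => (Real.sqrt (1 + ‖gradient f y‖ ^ 2))⁻¹ • gradient f y) x

/-- The graph of `u : U × [0, T] → ℝ` (`U` an open subset of `ℝⁿ`) flows by mean curvature:
`u` is continuous on `U × [0, T]`, and on the open set `U × (0, T)` it is smooth, jointly in space
and time, and solves `u_t = √(1 + |du|²) * div (du / √(1 + |du|²))`.
Every `u` that is smooth on `U × [0, T]` and solves the equation there is included; no control of
derivatives as `t → 0`, and no control of `u` near the lateral boundary, is demanded.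
Values of `u` outside `U × [0, T]` are irrelevant. -/
structure GraphFlowsByMeanCurvature {n : ℕ} (U : Set (EuclideanSpace ℝ (Fin n))) (T : ℝ)
    (u : EuclideanSpace ℝ (Fin n) → ℝ → ℝ) : Prop where
  continuousOn : ContinuousOn (fun p : EuclideanSpace ℝ (Fin n) × ℝ => u p.1 p.2)
    (U ×ˢ Set.Icc 0 T)
  smooth : ContDiffOn ℝ ∞ (fun p : EuclideanSpace ℝ (Fin n) × ℝ => u p.1 p.2)
    (U ×ˢ Set.Ioo 0 T)
  equation : ∀ x ∈ U, ∀ t ∈ Set.Ioo (0 : ℝ) T,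
    deriv (fun s => u x s) t = graphMeanCurvatureOp (fun y => u y t) x

/-- The supremum of `|f|` over `s` (the sup norm when `f` is bounded on a nonempty `s`). -/
def supNormOn {n : ℕ} (s : Set (EuclideanSpace ℝ (Fin n)))
    (f : EuclideanSpace ℝ (Fin n) → ℝ) : ℝ :=
  sSup ((fun x => |f x|) '' s)

end

open Filter Topology Metric Set

/-!
Comparison with shrinking spheres, on which `|x - x₀|² + (u - h)² + 2nt` is constant, bounds
`|u|` by `‖u(·, 0)‖ + 3r/2` on `closedBall 0 r` up to time `r² / (4n)`. The gradient is then
bounded by the maximum principle for `(exp (K φ) - 1) √(1 + |Du|²)`. At a maximum, `√(1 + |Du|²)`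
may be replaced by `√(1 + w²)`, where `w` is the derivative of `u` in the direction that `Du` has
at that point, and `(1 + w²)^{-1/2}` is a supersolution of the linear parabolic equation of the
graph. The localizer `φ` is positive only inside a parabolic cylinder and is tilted by a multiple
of `-u`, so that where `Du` is large the gradient of `φ` is large in the graph metric, and the
term quadratic in it wins as soon as `K` is a large multiple of `(1 + r⁻¹ ‖u(·, 0)‖)²`. The
maximum therefore occurs where `Du` is controlled; evaluating at the centre of the cylinder loses
only a factor `exp K`.
-/

section SecondDerivatives

variable {V F : Type*} [NormedAddCommGroup V] [NormedSpace ℝ V]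
  [NormedAddCommGroup F] [NormedSpace ℝ F]

theorem fderiv_fderiv_apply {f : V → F} {z : V} (hf : ContDiffAt ℝ 2 f z) (c : V) :
    fderiv ℝ (fun y => fderiv ℝ f y c) z = fderiv ℝ (fderiv ℝ f) z c := by
  have hf' : DifferentiableAt ℝ (fderiv ℝ f) z :=
    (hf.fderiv_right (m := 1) (by norm_num)).differentiableAt (by simp)
  ext a
  rw [fderiv_clm_apply hf' (differentiableAt_const c)]
  simpa using hf.isSymmSndFDerivAt (by simp) a c

theorem fderiv_fderiv_fderiv_apply {f : V → F} {z : V} (hf : ContDiffAt ℝ 3 f z) (c : V) :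
    fderiv ℝ (fderiv ℝ fun y => fderiv ℝ f y c) z = fderiv ℝ (fderiv ℝ (fderiv ℝ f)) z c := by
  have h : fderiv ℝ (fun y => fderiv ℝ f y c) =ᶠ[𝓝 z] fun y => fderiv ℝ (fderiv ℝ f) y c :=
    (hf.eventually (by simp)).mono fun y hy => fderiv_fderiv_apply (hy.of_le (by norm_num)) c
  rw [h.fderiv_eq, fderiv_fderiv_apply (hf.fderiv_right (by norm_num))]

theorem fderiv_fderiv_comp {f : V → ℝ} {z : V} (hf : ContDiffAt ℝ 2 f z) {g g' : ℝ → ℝ} {g'' : ℝ}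
    (hg : ∀ᶠ s in 𝓝 (f z), HasDerivAt g (g' s) s) (hg' : HasDerivAt g' g'' (f z)) (a : V) :
    fderiv ℝ (fderiv ℝ fun y => g (f y)) z a a =
      g' (f z) * fderiv ℝ (fderiv ℝ f) z a a + g'' * fderiv ℝ f z a ^ 2 := by
  have hfd := hf.differentiableAt (by simp)
  have hf' : DifferentiableAt ℝ (fderiv ℝ f) z :=
    (hf.fderiv_right (m := 1) (by norm_num)).differentiableAt (by simp)
  have h : fderiv ℝ (fun y => g (f y)) =ᶠ[𝓝 z] fun y => g' (f y) • fderiv ℝ f y := by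
    filter_upwards [hf.eventually (by simp), hf.continuousAt.eventually hg] with y hy hgy
    exact (hgy.comp_hasFDerivAt y (hy.differentiableAt (by simp)).hasFDerivAt).fderiv
  have h' := (hg'.comp_hasFDerivAt z hfd.hasFDerivAt).fun_smul hf'.hasFDerivAt
  simp only [Function.comp_apply] at h'
  rw [h.fderiv_eq, h'.fderiv]
  simp only [add_apply, smul_apply, ContinuousLinearMap.smulRight_apply, smul_eq_mul]
  ring

theorem hasDerivAt_fderiv_along_line {f : V → F} {z : V} (hf : ContDiffAt ℝ 2 f z) (c : V) :
    HasDerivAt (fun s : ℝ => fderiv ℝ f (z + s • c)) (fderiv ℝ (fun y => fderiv ℝ f y c) z) 0 := by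
  rw [fderiv_fderiv_apply hf]
  exact ((hf.fderiv_right (m := 1) (by norm_num)).differentiableAt
    (by simp)).hasFDerivAt.hasLineDerivAt c

theorem hasDerivAt_fderiv_fderiv_along_line {f : V → F} {z : V} (hf : ContDiffAt ℝ 3 f z) (c : V) :
    HasDerivAt (fun s : ℝ => fderiv ℝ (fderiv ℝ f) (z + s • c))
      (fderiv ℝ (fderiv ℝ fun y => fderiv ℝ f y c) z) 0 := by
  have hf' : ContDiffAt ℝ 2 (fderiv ℝ f) z := hf.fderiv_right (by norm_num)
  rw [fderiv_fderiv_fderiv_apply hf, ← fderiv_fderiv_apply hf']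
  exact hasDerivAt_fderiv_along_line hf' c

theorem hasDerivAt_clm_apply₂ {B : ℝ → V →L[ℝ] V →L[ℝ] F} {B' : V →L[ℝ] V →L[ℝ] F} {a b : ℝ → V}
    {a' b' : V} {t : ℝ} (hB : HasDerivAt B B' t) (ha : HasDerivAt a a' t)
    (hb : HasDerivAt b b' t) :
    HasDerivAt (fun s => B s (a s) (b s)) (B' (a t) (b t) + B t a' (b t) + B t (a t) b') t :=
  (hB.clm_apply ha).clm_apply hb

theorem fderiv_fderiv_nonpos_of_isLocalMax {f : V → ℝ} {z : V} (hf : ContDiffAt ℝ 2 f z) {a : V}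
    (hmax : IsLocalMax (fun s : ℝ => f (z + s • a)) 0) :
    fderiv ℝ (fderiv ℝ f) z a a ≤ 0 := by
  have hline (s : ℝ) : HasDerivAt (fun s : ℝ => z + s • a) a s := by
    simpa using ((hasDerivAt_id s).smul_const a).const_add z
  have hderiv : deriv (fun s : ℝ => f (z + s • a)) =ᶠ[𝓝 0] fun s => fderiv ℝ f (z + s • a) a := by
    have hcont : Tendsto (fun s : ℝ => z + s • a) (𝓝 0) (𝓝 z) := by
      simpa using (hline 0).continuousAt.tendsto
    filter_upwards [hcont.eventually (hf.eventually (by simp))] with s hs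
    exact ((hs.differentiableAt (by simp)).hasFDerivAt.comp_hasDerivAt s (hline s)).deriv
  have hderiv2 : deriv (deriv fun s : ℝ => f (z + s • a)) 0 = fderiv ℝ (fderiv ℝ f) z a a := by
    have h := ((hf.fderiv_right (m := 1) (by norm_num)).clm_apply
      (contDiffAt_const (c := a))).differentiableAt (by simp) |>.hasFDerivAt.hasLineDerivAt a
    rw [hderiv.deriv_eq, HasDerivAt.deriv h, fderiv_fderiv_apply hf]
  by_contra! hpos
  have hmin : IsLocalMin (fun s : ℝ => f (z + s • a)) 0 :=
    isLocalMin_of_deriv_deriv_pos (hderiv2 ▸ hpos) hmax.deriv_eq_zero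
      (ContinuousAt.comp_of_eq hf.continuousAt (hline 0).continuousAt (by simp))
  have hconst : (fun s : ℝ => f (z + s • a)) =ᶠ[𝓝 0] fun _ => f (z + (0 : ℝ) • a) :=
    hmin.mp (hmax.mono fun s hs hs' => le_antisymm hs hs')
  rw [hconst.deriv.deriv_eq] at hderiv2
  simp only [deriv_const', deriv_const] at hderiv2
  exact hpos.ne hderiv2

end SecondDerivatives

section HeatOperator

theorem isLocalMaxOn_past_of_isMaxOn {X : Type*} [TopologicalSpace X]
    {g : X × ℝ → ℝ} {K : Set X} {t₁ t₂ : ℝ} {z : X × ℝ}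
    (hmax : IsMaxOn g (K ×ˢ Icc t₁ t₂) z) (hz : z ∈ interior K ×ˢ Ioc t₁ t₂) :
    IsLocalMaxOn g {y | y.2 ≤ z.2} z := by
  have hK : ∀ᶠ y in 𝓝[{y : X × ℝ | y.2 ≤ z.2}] z, y.1 ∈ K :=
    (continuous_fst.continuousAt.eventually (mem_interior_iff_mem_nhds.1 hz.1)).filter_mono
      nhdsWithin_le_nhds
  have ht₁ : ∀ᶠ y in 𝓝[{y : X × ℝ | y.2 ≤ z.2}] z, t₁ < y.2 :=
    (continuous_snd.continuousAt.eventually (lt_mem_nhds hz.2.1)).filter_mono nhdsWithin_le_nhds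
  filter_upwards [hK, ht₁, self_mem_nhdsWithin] with y hyK hy₁ hy₂
  exact hmax ⟨hyK, hy₁.le, le_trans hy₂ hz.2.2⟩

variable {E : Type*} [NormedAddCommGroup E] [NormedSpace ℝ E] {ι : Type*} [Fintype ι]

/-- The heat operator `∂ₜ g - ∑ₖ ∂_{bₖ}² g` of a family `b` of constant spatial directions, on
functions of `(x, t) ∈ E × ℝ`. -/
noncomputable def heatOp (b : ι → E) (g : E × ℝ → ℝ) (z : E × ℝ) : ℝ :=
  fderiv ℝ g z (0, 1) - ∑ k, fderiv ℝ (fderiv ℝ g) z (b k, 0) (b k, 0)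

theorem heatOp_add (b : ι → E) {f g : E × ℝ → ℝ} {z : E × ℝ} (hf : ContDiffAt ℝ 2 f z)
    (hg : ContDiffAt ℝ 2 g z) :
    heatOp b (fun y => f y + g y) z = heatOp b f z + heatOp b g z := by
  have h : fderiv ℝ (fun y => f y + g y) =ᶠ[𝓝 z] fun y => fderiv ℝ f y + fderiv ℝ g y := by
    filter_upwards [hf.eventually (by simp), hg.eventually (by simp)] with y hfy hgy
    exact fderiv_fun_add (hfy.differentiableAt (by simp)) (hgy.differentiableAt (by simp))
  have hf' := (hf.fderiv_right (m := 1) (by norm_num)).differentiableAt (by simp)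
  have hg' := (hg.fderiv_right (m := 1) (by norm_num)).differentiableAt (by simp)
  simp only [heatOp, h.fderiv_eq, h.self_of_nhds, fderiv_fun_add hf' hg',
    add_apply, Finset.sum_add_distrib]
  ring

theorem heatOp_comp (b : ι → E) {f : E × ℝ → ℝ} {z : E × ℝ} (hf : ContDiffAt ℝ 2 f z)
    {g g' : ℝ → ℝ} {g'' : ℝ} (hg : ∀ᶠ s in 𝓝 (f z), HasDerivAt g (g' s) s)
    (hg' : HasDerivAt g' g'' (f z)) :
    heatOp b (fun y => g (f y)) z =
      g' (f z) * heatOp b f z - g'' * ∑ k, fderiv ℝ f z (b k, 0) ^ 2 := by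
  have h : fderiv ℝ (fun y => g (f y)) z = g' (f z) • fderiv ℝ f z :=
    (hg.self_of_nhds.comp_hasFDerivAt z (hf.differentiableAt (by simp)).hasFDerivAt).fderiv
  simp only [heatOp, h, fderiv_fderiv_comp hf hg hg', Finset.sum_add_distrib, ← Finset.mul_sum,
    smul_apply, smul_eq_mul]
  ring

theorem heatOp_affine_comp (b : ι → E) {f : E × ℝ → ℝ} {z : E × ℝ} (hf : ContDiffAt ℝ 2 f z)
    (c d : ℝ) : heatOp b (fun y => c * f y + d) z = c * heatOp b f z := by
  simpa using heatOp_comp b hf (g := fun s => c * s + d) (g' := fun _ => c)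
    (.of_forall fun s => by simpa using ((hasDerivAt_id s).const_mul c).add_const d)
    (hasDerivAt_const (f z) c)

theorem heatOp_const_mul (b : ι → E) {f : E × ℝ → ℝ} {z : E × ℝ} (hf : ContDiffAt ℝ 2 f z)
    (c : ℝ) : heatOp b (fun y => c * f y) z = c * heatOp b f z := by
  simpa using heatOp_affine_comp b hf c 0

theorem heatOp_snd (b : ι → E) (z : E × ℝ) : heatOp b Prod.snd z = 1 := by
  have h : fderiv ℝ (Prod.snd : E × ℝ → ℝ) = fun _ => ContinuousLinearMap.snd ℝ E ℝ :=
    funext fun _ => fderiv_snd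
  simp [heatOp, h]

theorem heatOp_nonneg_of_isLocalMaxOn (b : ι → E) {g : E × ℝ → ℝ} {z : E × ℝ}
    (hg : ContDiffAt ℝ 2 g z) (hmax : IsLocalMaxOn g {y | y.2 ≤ z.2} z) : 0 ≤ heatOp b g z := by
  have htime : 0 ≤ fderiv ℝ g z (0, 1) := by
    have hcone : ((0 : E), (-1 : ℝ)) ∈ posTangentConeAt {y : E × ℝ | y.2 ≤ z.2} z := by
      refine mem_posTangentConeAt_of_segment_subset ?_
      rw [segment_eq_image']
      rintro _ ⟨s, hs, rfl⟩
      simpa using hs.1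
    have h := hmax.hasFDerivWithinAt_nonpos
      (hg.differentiableAt (by simp)).hasFDerivAt.hasFDerivWithinAt hcone
    rw [show ((0 : E), (-1 : ℝ)) = -(0, 1) by simp, map_neg] at h
    linarith
  have hspace (k : ι) : fderiv ℝ (fderiv ℝ g) z (b k, 0) (b k, 0) ≤ 0 := by
    refine fderiv_fderiv_nonpos_of_isLocalMax hg ?_
    have hline : Tendsto (fun s : ℝ => z + s • (b k, (0 : ℝ))) (𝓝 0) (𝓝[{y | y.2 ≤ z.2}] z) := by
      refine tendsto_nhdsWithin_iff.2 ⟨?_, .of_forall fun s => by simp⟩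
      exact (by fun_prop : Continuous fun s : ℝ => z + s • (b k, (0 : ℝ))).tendsto' 0 z (by simp)
    simpa [IsLocalMax, IsMaxFilter] using hline.eventually hmax
  exact sub_nonneg.2 ((Finset.sum_nonpos fun k _ => hspace k).trans htime)

end HeatOperator

section MinimumPrinciple

variable {E : Type*} [NormedAddCommGroup E] [NormedSpace ℝ E] {ι : Type*} [Fintype ι]

theorem le_of_heatOp_nonneg {K : Set E} (hK : IsCompact K) {T m : ℝ} {b : E × ℝ → ι → E}
    {g : E × ℝ → ℝ} (hcont : ContinuousOn g (K ×ˢ Icc 0 T))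
    (hdiff : ∀ z ∈ interior K ×ˢ Ioc 0 T, ContDiffAt ℝ 2 g z)
    (hsuper : ∀ z ∈ interior K ×ˢ Ioc 0 T, 0 ≤ heatOp (b z) g z)
    (hbottom : ∀ x ∈ K, m ≤ g (x, 0)) (hside : ∀ x ∈ K \ interior K, ∀ t ∈ Icc 0 T, m ≤ g (x, t))
    {z : E × ℝ} (hz : z ∈ K ×ˢ Icc 0 T) : m ≤ g z := by
  -- `g + ε t` is a strict supersolution, so its minimum lies on the parabolic boundary.
  suffices h : ∀ ε > 0, m ≤ g z + ε * z.2 by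
    by_contra! hlt
    have hpos : 0 < z.2 + 1 := by linarith [hz.2.1]
    have hε := h ((m - g z) / (z.2 + 1)) (div_pos (sub_pos.2 hlt) hpos)
    have hmul : (m - g z) / (z.2 + 1) * (z.2 + 1) = m - g z := div_mul_cancel₀ _ hpos.ne'
    linarith [div_pos (sub_pos.2 hlt) hpos]
  intro ε hε
  obtain ⟨w, hw, hmin⟩ := (hK.prod isCompact_Icc).exists_isMinOn ⟨z, hz⟩
    (hcont.fun_add (g := fun y => ε * y.2) (by fun_prop))
  refine le_trans ?_ (hmin hz)
  have hdrift : 0 ≤ ε * w.2 := mul_nonneg hε.le hw.2.1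
  by_cases hint : w ∈ interior K ×ˢ Ioc 0 T
  · have hsmooth := hdiff w hint
    have hneg : ContDiffAt ℝ 2 (fun y => (-1) * g y) w := by fun_prop
    have htime : ContDiffAt ℝ 2 (fun y : E × ℝ => (-ε) * y.2) w := by fun_prop
    have hmax : IsMaxOn (fun y => (-1) * g y + (-ε) * y.2) (K ×ˢ Icc 0 T) w := by
      intro y hy
      have hy := hmin hy
      simp only [mem_ofPred_eq] at hy ⊢
      linarith
    have hnonneg := heatOp_nonneg_of_isLocalMaxOn (b w) (hneg.add htime)
      (isLocalMaxOn_past_of_isMaxOn hmax hint)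
    rw [heatOp_add _ hneg htime, heatOp_const_mul _ hsmooth, heatOp_const_mul _ contDiffAt_snd,
      heatOp_snd] at hnonneg
    linarith [hsuper w hint]
  · have hm : m ≤ g w := by
      rcases hw.2.1.eq_or_lt with h0 | h0
      · simpa [h0] using hbottom w.1 hw.1
      · exact hside w.1 ⟨hw.1, fun h => hint ⟨h, h0, hw.2.2⟩⟩ w.2 hw.2
    simpa using hm.trans (le_add_of_nonneg_right hdrift)

end MinimumPrinciple

section GraphHeatOperator

variable {E : Type*} [NormedAddCommGroup E] [InnerProductSpace ℝ E] {ι : Type*} [Fintype ι]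

theorem heatOp_norm_sub_sq (b : ι → E) (x₀ : E) (z : E × ℝ) :
    heatOp b (fun y => ‖y.1 - x₀‖ ^ 2) z = -2 * ∑ k, ‖b k‖ ^ 2 := by
  have h (y : E × ℝ) : fderiv ℝ (fun y : E × ℝ => ‖y.1 - x₀‖ ^ 2) y =
      2 • (innerSL ℝ (y.1 - x₀)).comp (ContinuousLinearMap.fst ℝ E ℝ) :=
    (hasFDerivAt_fst.sub_const x₀).norm_sq.fderiv
  have h' (k : ι) :
      fderiv ℝ (fderiv ℝ fun y : E × ℝ => ‖y.1 - x₀‖ ^ 2) z (b k, 0) (b k, 0) =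
        2 * ‖b k‖ ^ 2 := by
    have hd : HasFDerivAt (fun y : E × ℝ => inner ℝ (y.1 - x₀) (b k)) _ z :=
      (hasFDerivAt_fst.sub_const x₀).inner ℝ (hasFDerivAt_const (b k) z)
    rw [← fderiv_fderiv_apply ((contDiffAt_fst.sub contDiffAt_const).norm_sq ℝ)]
    simp only [h, smul_apply, ContinuousLinearMap.comp_apply, ContinuousLinearMap.coe_fst',
      innerSL_apply_apply]
    rw [(hd.fun_const_smul 2).fderiv]
    simp
  simp [heatOp, h', h, ← Finset.mul_sum]

/-- Vectors `bₖ` with `∑ₖ bₖ ⊗ bₖ = 1 - P ⊗ P / (1 + ‖P‖²)`, the inverse of the metric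
`1 + P ⊗ P` induced on a graph with gradient `P`; the coefficient is the one that turns an
orthonormal basis into a `(1 + P ⊗ P)`-orthonormal one. -/
noncomputable def graphFrame (e : OrthonormalBasis ι ℝ E) (P : E) (k : ι) : E :=
  e k - ((√(1 + ‖P‖ ^ 2) * (√(1 + ‖P‖ ^ 2) + 1))⁻¹ * inner ℝ P (e k)) • P

theorem sum_graphFrame (e : OrthonormalBasis ι ℝ E) (P : E) (B : E →ₗ[ℝ] E →ₗ[ℝ] ℝ) :
    ∑ k, B (graphFrame e P k) (graphFrame e P k) =
      ∑ k, B (e k) (e k) - (1 + ‖P‖ ^ 2)⁻¹ * B P P := by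
  set v := √(1 + ‖P‖ ^ 2)
  set κ := (v * (v + 1))⁻¹
  have hv2 : v ^ 2 = 1 + ‖P‖ ^ 2 := Real.sq_sqrt (by positivity)
  have hv0 : 0 < v := Real.sqrt_pos.2 (by positivity)
  have hP : ∑ k, inner ℝ P (e k) • e k = P := by
    simpa only [real_inner_comm] using e.sum_repr' P
  have hleft : ∑ k, inner ℝ P (e k) * B (e k) P = B P P := by
    simpa using congrArg (fun v => B v P) hP
  have hright : ∑ k, inner ℝ P (e k) * B P (e k) = B P P := by
    simpa using congrArg (fun v => B P v) hP
  have hnorm : ∑ k, inner ℝ P (e k) ^ 2 = v ^ 2 - 1 := by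
    rw [e.sum_sq_inner_left, hv2]; ring
  have hterm (k : ι) : B (graphFrame e P k) (graphFrame e P k) =
      B (e k) (e k) - κ * (inner ℝ P (e k) * B (e k) P) - κ * (inner ℝ P (e k) * B P (e k)) +
        κ ^ 2 * B P P * inner ℝ P (e k) ^ 2 := by
    simp only [graphFrame, map_sub, map_smul, LinearMap.sub_apply,
      LinearMap.smul_apply, smul_eq_mul]
    ring
  have hκ : κ ^ 2 * (v ^ 2 - 1) - 2 * κ = -(v ^ 2)⁻¹ := by
    simp only [κ]
    field_simp
    ring
  simp only [hterm, Finset.sum_add_distrib, Finset.sum_sub_distrib, ← Finset.mul_sum, hleft, hright,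
    hnorm, ← hv2]
  linear_combination B P P * hκ

theorem sum_norm_sq_graphFrame (e : OrthonormalBasis ι ℝ E) (P : E) :
    ∑ k, ‖graphFrame e P k‖ ^ 2 = Fintype.card ι - (1 + ‖P‖ ^ 2)⁻¹ * ‖P‖ ^ 2 := by
  simpa only [innerₗ_apply_apply, real_inner_self_eq_norm_sq, e.norm_eq_one, one_pow,
    Finset.sum_const, Finset.card_univ, nsmul_one] using sum_graphFrame e P (innerₗ E)

theorem sum_norm_sq_graphFrame_le (e : OrthonormalBasis ι ℝ E) (P : E) :
    ∑ k, ‖graphFrame e P k‖ ^ 2 ≤ Fintype.card ι :=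
  (sum_norm_sq_graphFrame e P).trans_le (sub_le_self _ (by positivity))

variable [CompleteSpace E]

/-- The Riesz representative of the spatial part of a functional on space-time, as a real linear
map (`toDual.symm` is only declared conjugate-linear). -/
noncomputable def spatialRiesz : StrongDual ℝ (E × ℝ) →L[ℝ] E where
  toFun ℓ := (InnerProductSpace.toDual ℝ E).symm (ℓ.comp (ContinuousLinearMap.inl ℝ E ℝ))
  map_add' := by simp
  map_smul' := by simp
  cont := by fun_prop

/-- The gradient in the space variable of a function on space-time. -/
noncomputable def spaceGrad (f : E × ℝ → ℝ) (z : E × ℝ) : E :=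
  spatialRiesz (fderiv ℝ f z)

theorem inner_spaceGrad (f : E × ℝ → ℝ) (z : E × ℝ) (a : E) :
    inner ℝ (spaceGrad f z) a = fderiv ℝ f z (a, 0) := by
  simp [spaceGrad, spatialRiesz]

theorem hasFDerivAt_spaceGrad {f : E × ℝ → ℝ} {z : E × ℝ} (hf : ContDiffAt ℝ 2 f z) :
    HasFDerivAt (spaceGrad f) (spatialRiesz.comp (fderiv ℝ (fderiv ℝ f) z)) z :=
  (spatialRiesz (E := E)).hasFDerivAt.comp z
    ((hf.fderiv_right (m := 1) (by norm_num)).differentiableAt (by simp)).hasFDerivAt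

/-- The operator `∂ₜ - tr_{A⁻¹} D²` acting on `g`, for the metric `A = 1 + Df ⊗ Df` of the graph
of `f`. The equation `graphHeatOp e f f = 0` is mean curvature flow of the graph. -/
noncomputable def graphHeatOp (e : OrthonormalBasis ι ℝ E) (f g : E × ℝ → ℝ) (z : E × ℝ) : ℝ :=
  heatOp (graphFrame e (spaceGrad f z)) g z

theorem graphHeatOp_eq (e : OrthonormalBasis ι ℝ E) (f g : E × ℝ → ℝ) (z : E × ℝ) :
    graphHeatOp e f g z = fderiv ℝ g z (0, 1) -
      ∑ k, fderiv ℝ (fderiv ℝ g) z (e k, 0) (e k, 0) +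
      (1 + ‖spaceGrad f z‖ ^ 2)⁻¹ *
        fderiv ℝ (fderiv ℝ g) z (spaceGrad f z, 0) (spaceGrad f z, 0) := by
  have h := sum_graphFrame e (spaceGrad f z) ((fderiv ℝ (fderiv ℝ g) z).bilinearComp
    (ContinuousLinearMap.inl ℝ E ℝ) (ContinuousLinearMap.inl ℝ E ℝ)).toLinearMap₁₂
  simp only [ContinuousLinearMap.toLinearMap₁₂_apply_apply_apply,
    ContinuousLinearMap.bilinearComp_apply, ContinuousLinearMap.inl_apply] at h
  rw [graphHeatOp, heatOp, h]
  ring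

theorem one_add_norm_sq_mul_graphHeatOp (e : OrthonormalBasis ι ℝ E) (f g : E × ℝ → ℝ)
    (z : E × ℝ) : (1 + ‖spaceGrad f z‖ ^ 2) * graphHeatOp e f g z =
      (1 + ‖spaceGrad f z‖ ^ 2) *
        (fderiv ℝ g z (0, 1) - ∑ k, fderiv ℝ (fderiv ℝ g) z (e k, 0) (e k, 0)) +
      fderiv ℝ (fderiv ℝ g) z (spaceGrad f z, 0) (spaceGrad f z, 0) := by
  rw [graphHeatOp_eq]
  field_simp

theorem sum_fderiv_graphFrame_sq (e : OrthonormalBasis ι ℝ E) (P : E) (g : E × ℝ → ℝ)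
    (z : E × ℝ) : ∑ k, fderiv ℝ g z (graphFrame e P k, 0) ^ 2 =
      ‖spaceGrad g z‖ ^ 2 - (1 + ‖P‖ ^ 2)⁻¹ * inner ℝ P (spaceGrad g z) ^ 2 := by
  have h := sum_graphFrame e P ((innerₗ E (spaceGrad g z)).smulRight (innerₗ E (spaceGrad g z)))
  simp only [LinearMap.smulRight_apply, LinearMap.smul_apply, innerₗ_apply_apply, smul_eq_mul,
    ← sq, e.sum_sq_inner_left] at h
  simpa only [← inner_spaceGrad, real_inner_comm P] using h

end GraphHeatOperator

section Evolution

variable {E : Type*} [NormedAddCommGroup E] [InnerProductSpace ℝ E] [CompleteSpace E]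
  {ι : Type*} [Fintype ι]

/-- The equation, multiplied by `1 + ‖Df‖²`, differentiated in the fixed direction `c`. -/
theorem linearized_graphHeatOp (e : OrthonormalBasis ι ℝ E) {f : E × ℝ → ℝ} {z : E × ℝ}
    (hf : ContDiffAt ℝ 3 f z) (heq : ∀ᶠ y in 𝓝 z, graphHeatOp e f f y = 0) (c : E)
    {w : E × ℝ → ℝ} (hw : w = fun y => fderiv ℝ f y (c, 0)) :
    (1 + ‖spaceGrad f z‖ ^ 2) * graphHeatOp e f w z +
      2 * inner ℝ (spaceGrad f z) (spaceGrad w z) *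
        (fderiv ℝ f z (0, 1) - ∑ k, fderiv ℝ (fderiv ℝ f) z (e k, 0) (e k, 0)) +
      2 * fderiv ℝ (fderiv ℝ f) z (spaceGrad f z, 0) (spaceGrad w z, 0) = 0 := by
  have hf2 : ContDiffAt ℝ 2 f z := hf.of_le (by norm_num)
  have hP : HasDerivAt (fun s : ℝ => spaceGrad f (z + s • (c, (0 : ℝ)))) (spaceGrad w z) 0 := by
    have h := (hasFDerivAt_spaceGrad hf2).hasLineDerivAt (c, 0)
    rwa [HasLineDerivAt, ContinuousLinearMap.comp_apply, ← fderiv_fderiv_apply hf2, ← hw] at h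
  have hD : HasDerivAt (fun s : ℝ => fderiv ℝ f (z + s • (c, (0 : ℝ)))) (fderiv ℝ w z) 0 :=
    hw ▸ hasDerivAt_fderiv_along_line hf2 _
  have hH : HasDerivAt (fun s : ℝ => fderiv ℝ (fderiv ℝ f) (z + s • (c, (0 : ℝ))))
      (fderiv ℝ (fderiv ℝ w) z) 0 := hw ▸ hasDerivAt_fderiv_fderiv_along_line hf _
  have hHess {a b : ℝ → E} {a' b' : E} (ha : HasDerivAt a a' 0) (hb : HasDerivAt b b' 0) :
      HasDerivAt (fun s => fderiv ℝ (fderiv ℝ f) (z + s • (c, (0 : ℝ))) (a s, 0) (b s, 0))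
        (fderiv ℝ (fderiv ℝ w) z (a 0, 0) (b 0, 0) + fderiv ℝ (fderiv ℝ f) z (a', 0) (b 0, 0) +
          fderiv ℝ (fderiv ℝ f) z (a 0, 0) (b', 0)) 0 := by
    simpa only [zero_smul, add_zero] using hasDerivAt_clm_apply₂ hH
      (ha.prodMk (hasDerivAt_const 0 (0 : ℝ))) (hb.prodMk (hasDerivAt_const 0 (0 : ℝ)))
  have hLaplace := HasDerivAt.fun_sum fun k (_ : k ∈ Finset.univ) =>
    hHess (hasDerivAt_const 0 (e k)) (hasDerivAt_const 0 (e k))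
  have hderiv := ((hP.norm_sq.const_add 1).fun_mul
    ((hD.clm_apply (hasDerivAt_const 0 ((0 : E), (1 : ℝ)))).fun_sub hLaplace)).fun_add (hHess hP hP)
  simp only [zero_smul, add_zero, Prod.mk_zero_zero, map_zero, zero_apply] at hderiv
  have hline : Tendsto (fun s : ℝ => z + s • (c, (0 : ℝ))) (𝓝 0) (𝓝 z) :=
    (by fun_prop : Continuous fun s : ℝ => z + s • (c, (0 : ℝ))).tendsto' 0 z (by simp)
  have hzero := hderiv.unique ((hasDerivAt_const 0 (0 : ℝ)).congr_of_eventuallyEq <|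
    (hline.eventually heq).mono fun s hs => by
      beta_reduce
      rw [← one_add_norm_sq_mul_graphHeatOp, hs, mul_zero])
  have hsymm := hf2.isSymmSndFDerivAt (by simp) (spaceGrad w z, 0) (spaceGrad f z, 0)
  rw [one_add_norm_sq_mul_graphHeatOp]
  linarith

theorem graphHeatOp_fderiv_of_smul_eq_spaceGrad (e : OrthonormalBasis ι ℝ E) {f : E × ℝ → ℝ}
    {z : E × ℝ} (hf : ContDiffAt ℝ 3 f z) (heq : ∀ᶠ y in 𝓝 z, graphHeatOp e f f y = 0) {c : E}
    (hc : ‖spaceGrad f z‖ • c = spaceGrad f z) {w : E × ℝ → ℝ}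
    (hw : w = fun y => fderiv ℝ f y (c, 0)) :
    graphHeatOp e f w z = -(2 * ‖spaceGrad f z‖ / (1 + ‖spaceGrad f z‖ ^ 2)) *
      ∑ k, fderiv ℝ w z (graphFrame e (spaceGrad f z) k, 0) ^ 2 := by
  have hlin := linearized_graphHeatOp e hf heq c hw
  have heqz := heq.self_of_nhds
  rw [graphHeatOp_eq] at heqz
  rw [sum_fderiv_graphFrame_sq]
  set P := spaceGrad f z
  set W := spaceGrad w z
  have hHess (a : E) : fderiv ℝ (fderiv ℝ f) z (P, 0) (a, 0) = ‖P‖ * inner ℝ W a := by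
    rw [inner_spaceGrad, hw, fderiv_fderiv_apply (hf.of_le (by norm_num)), ← smul_eq_mul,
      ← smul_apply, ← map_smul, Prod.smul_mk, smul_zero, hc]
  have hPW : inner ℝ W P = ‖P‖ * inner ℝ W c := by rw [← hc, inner_smul_right, hc]
  rw [hHess, real_inner_self_eq_norm_sq, real_inner_comm, hPW] at hlin
  rw [hHess, hPW] at heqz
  rw [real_inner_comm, hPW]
  field_simp at heqz hlin ⊢
  linear_combination (1 + ‖P‖ ^ 2) * hlin - 2 * ‖P‖ * inner ℝ W c * heqz

theorem hasDerivAt_inv_sqrt_one_add {s : ℝ} (hs : 0 < 1 + s) :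
    HasDerivAt (fun s : ℝ => (√(1 + s))⁻¹) (-((√(1 + s))⁻¹ ^ 3 / 2)) s := by
  convert! (((hasDerivAt_id s).const_add 1).sqrt hs.ne').fun_inv (Real.sqrt_ne_zero'.2 hs) using 1
  simp only [id]
  field_simp

theorem hasDerivAt_inv_sqrt_one_add_sq (s : ℝ) :
    HasDerivAt (fun s : ℝ => (√(1 + s ^ 2))⁻¹) (-s * (√(1 + s ^ 2))⁻¹ ^ 3) s := by
  convert! (hasDerivAt_inv_sqrt_one_add (by positivity)).comp s ((hasDerivAt_id s).fun_pow 2)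
    using 1
  simp only [id]
  ring

theorem hasDerivAt_deriv_inv_sqrt_one_add_sq (s : ℝ) :
    HasDerivAt (fun s : ℝ => -s * (√(1 + s ^ 2))⁻¹ ^ 3)
      (3 * s ^ 2 * (√(1 + s ^ 2))⁻¹ ^ 5 - (√(1 + s ^ 2))⁻¹ ^ 3) s := by
  convert! (hasDerivAt_neg s).mul ((hasDerivAt_inv_sqrt_one_add_sq s).pow 3) using 1
  simp only [inv_pow, Pi.pow_apply, neg_mul, one_mul, Nat.cast_ofNat, Nat.add_one_sub_one, mul_neg,
    neg_neg]
  ring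

/-- Freezing the direction `c` of `Df` at `z` avoids differentiating the norm of the gradient, and
so also the case distinction at `Df = 0`. -/
theorem graphHeatOp_inv_sqrt_nonneg (e : OrthonormalBasis ι ℝ E) {f : E × ℝ → ℝ} {z : E × ℝ}
    (hf : ContDiffAt ℝ 3 f z) (heq : ∀ᶠ y in 𝓝 z, graphHeatOp e f f y = 0) {c : E}
    (hc : ‖spaceGrad f z‖ • c = spaceGrad f z) {w : E × ℝ → ℝ}
    (hw : w = fun y => fderiv ℝ f y (c, 0)) (hwz : w z = ‖spaceGrad f z‖) :
    0 ≤ graphHeatOp e f (fun y => (√(1 + w y ^ 2))⁻¹) z := by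
  have hw2 : ContDiffAt ℝ 2 w z := hw ▸ (hf.fderiv_right (by norm_num)).clm_apply contDiffAt_const
  have hw' := graphHeatOp_fderiv_of_smul_eq_spaceGrad e hf heq hc hw
  unfold graphHeatOp at hw' ⊢
  rw [heatOp_comp _ hw2 (.of_forall hasDerivAt_inv_sqrt_one_add_sq)
    (hasDerivAt_deriv_inv_sqrt_one_add_sq _), hw', hwz]
  set p := ‖spaceGrad f z‖
  set Γ := ∑ k, fderiv ℝ w z (graphFrame e (spaceGrad f z) k, 0) ^ 2
  have hΓ : 0 ≤ Γ := Finset.sum_nonneg fun k _ => sq_nonneg _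
  have hv : 1 + p ^ 2 = √(1 + p ^ 2) ^ 2 := (Real.sq_sqrt (by positivity)).symm
  have hv0 : 0 < √(1 + p ^ 2) := by positivity
  set v := √(1 + p ^ 2)
  calc 0 ≤ v⁻¹ ^ 5 * Γ := mul_nonneg (by positivity) hΓ
    _ = _ := by
      rw [hv]
      field_simp
      linear_combination Γ * hv

theorem graphHeatOp_nonneg_of_isLocalMaxOn_mul_sqrt (e : OrthonormalBasis ι ℝ E) {f ψ : E × ℝ → ℝ}
    {z : E × ℝ} (hf : ContDiffAt ℝ 3 f z) (heq : ∀ᶠ y in 𝓝 z, graphHeatOp e f f y = 0)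
    (hψ : ContDiffAt ℝ 2 ψ z) (hψz : 0 ≤ ψ z)
    (hmax : IsLocalMaxOn (fun y => ψ y * √(1 + ‖spaceGrad f y‖ ^ 2)) {y | y.2 ≤ z.2} z) :
    0 ≤ graphHeatOp e f ψ z := by
  set c : E := NormedSpace.normalize (spaceGrad f z)
  have hc : ‖spaceGrad f z‖ • c = spaceGrad f z := NormedSpace.norm_smul_normalize _
  have hc1 : ‖c‖ ≤ 1 := by
    simpa [c, NormedSpace.normalize, norm_smul] using inv_mul_le_one
  have hwz : fderiv ℝ f z (c, 0) = ‖spaceGrad f z‖ := by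
    simp [← inner_spaceGrad, c, NormedSpace.normalize, inner_smul_right, sq, ← mul_assoc]
  have hw2 : ContDiffAt ℝ 2 (fun y => (√(1 + fderiv ℝ f y (c, 0) ^ 2))⁻¹) z := by
    have hw : ContDiffAt ℝ 2 (fun y => fderiv ℝ f y (c, 0)) z :=
      (hf.fderiv_right (by norm_num)).clm_apply contDiffAt_const
    exact ((contDiffAt_const.add (hw.pow 2)).sqrt (by positivity)).inv (by positivity)
  have hw_le (y : E × ℝ) : fderiv ℝ f y (c, 0) ^ 2 ≤ ‖spaceGrad f y‖ ^ 2 := by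
    rw [← inner_spaceGrad, ← sq_abs]
    gcongr
    exact (abs_real_inner_le_norm _ _).trans (mul_le_of_le_one_right (norm_nonneg _) hc1)
  set lam := ψ z * √(1 + ‖spaceGrad f z‖ ^ 2)
  have hlam : 0 ≤ lam := by positivity
  have hmax' : IsLocalMaxOn (fun y => ψ y + (-lam * (√(1 + fderiv ℝ f y (c, 0) ^ 2))⁻¹))
      {y | y.2 ≤ z.2} z := by
    filter_upwards [hmax] with y hy
    have hψy : ψ y ≤ lam * (√(1 + fderiv ℝ f y (c, 0) ^ 2))⁻¹ := calc
      ψ y ≤ lam * (√(1 + ‖spaceGrad f y‖ ^ 2))⁻¹ := by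
        rwa [← div_eq_mul_inv, le_div_iff₀ (by positivity)]
      _ ≤ _ := by gcongr lam * (√(1 + ?_))⁻¹; exact hw_le y
    have hψz' : lam * (√(1 + fderiv ℝ f z (c, 0) ^ 2))⁻¹ = ψ z := by
      rw [hwz, mul_inv_cancel_right₀ (by positivity)]
    linarith
  have h := heatOp_nonneg_of_isLocalMaxOn (graphFrame e (spaceGrad f z))
    (hψ.add (by fun_prop)) hmax'
  rw [heatOp_add _ hψ (by fun_prop), heatOp_const_mul _ hw2] at h
  have h' := mul_nonneg hlam (graphHeatOp_inv_sqrt_nonneg e hf heq hc rfl hwz)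
  unfold graphHeatOp at h' ⊢
  linarith

end Evolution

section Localizer

variable {E : Type*} [NormedAddCommGroup E]

/-- The function whose positivity set localizes the gradient estimate: a paraboloid growing in
time, tilted by `-c f` so that its spatial gradient is of size `c ‖Df‖` where `Df` is large. -/
def localizer (A B c d : ℝ) (x₀ : E) (f : E × ℝ → ℝ) (y : E × ℝ) : ℝ :=
  A * y.2 - B * ‖y.1 - x₀‖ ^ 2 - c * f y + d

theorem localizer_cylinder (x₀ : E) (f : E × ℝ → ℝ) (ρ t₁ t₂ m : ℝ) (z : E × ℝ) :
    localizer (t₂ - t₁)⁻¹ (ρ ^ 2)⁻¹ (2 * m)⁻¹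
      ((2 * m)⁻¹ * f (x₀, t₂) - (t₂ - t₁)⁻¹ * t₁ - 1 / 2) x₀ f z =
        (z.2 - t₁) / (t₂ - t₁) - (‖z.1 - x₀‖ / ρ) ^ 2 +
          ((f (x₀, t₂) - f z) / (2 * m) - 1 / 2) := by
  rw [localizer]
  ring

end Localizer

section InteriorEstimate

variable {E : Type*} [NormedAddCommGroup E] [InnerProductSpace ℝ E] {ι : Type*} [Fintype ι]

theorem sq_div_four_lt_of_lt_norm {X P : E} {c s : ℝ} (hc : 0 < c) (hX : ‖X‖ ≤ s)
    (hP : 1 + 2 * s / c < ‖P‖) :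
    c ^ 2 / 4 < ‖X + c • P‖ ^ 2 - (1 + ‖P‖ ^ 2)⁻¹ * inner ℝ P (X + c • P) ^ 2 := by
  have hs : 0 ≤ s := (norm_nonneg X).trans hX
  have hP0 : 0 < ‖P‖ := lt_of_le_of_lt (by positivity) hP
  set p := ‖P‖
  set I := inner ℝ P (X + c • P)
  have hI : p * (c / 2 * (1 + p)) < I := by
    have hinner : I = inner ℝ P X + c * p ^ 2 := by
      simp only [I, inner_add_right, inner_smul_right, real_inner_self_eq_norm_sq, p]
    have hPX : -(p * s) ≤ inner ℝ P X :=
      (neg_le_neg (by gcongr)).trans (neg_le_of_abs_le (abs_real_inner_le_norm P X))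
    have hgap : c + 2 * s < c * p := by
      calc c + 2 * s = c * (1 + 2 * s / c) := by field_simp
        _ < c * p := by gcongr
    rw [hinner]
    nlinarith
  have hCS : I ^ 2 ≤ p ^ 2 * ‖X + c • P‖ ^ 2 := by
    rw [← mul_pow, ← sq_abs]
    gcongr
    exact abs_real_inner_le_norm _ _
  have hsq : p ^ 2 * (c ^ 2 / 4 * (1 + p ^ 2)) < I ^ 2 := calc
    _ ≤ (p * (c / 2 * (1 + p))) ^ 2 := by
      rw [mul_pow, mul_pow]
      gcongr p ^ 2 * ?_
      nlinarith [sq_nonneg c]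
    _ < I ^ 2 := by gcongr
  have hmain : c ^ 2 / 4 * (1 + p ^ 2) < ‖X + c • P‖ ^ 2 * (1 + p ^ 2) - I ^ 2 := by
    refine lt_of_mul_lt_mul_left ?_ (sq_nonneg p)
    nlinarith
  refine lt_of_mul_lt_mul_right (hmain.trans_eq ?_) (by positivity : 0 ≤ 1 + p ^ 2)
  field_simp

variable [CompleteSpace E]

theorem mul_sum_sq_le_graphHeatOp (e : OrthonormalBasis ι ℝ E) {f φ : E × ℝ → ℝ} {z : E × ℝ}
    {K : ℝ} (hf : ContDiffAt ℝ 3 f z) (heq : ∀ᶠ y in 𝓝 z, graphHeatOp e f f y = 0)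
    (hφ : ContDiffAt ℝ 2 φ z) (hK : 0 < K) (hφz : 0 ≤ φ z)
    (hmax : IsLocalMaxOn (fun y => (Real.exp (K * φ y) - 1) * √(1 + ‖spaceGrad f y‖ ^ 2))
      {y | y.2 ≤ z.2} z) :
    K * ∑ k, fderiv ℝ φ z (graphFrame e (spaceGrad f z) k, 0) ^ 2 ≤ graphHeatOp e f φ z := by
  have hexp (s : ℝ) : HasDerivAt (fun s => Real.exp (K * s)) (K * Real.exp (K * s)) s := by
    simpa [mul_comm] using ((hasDerivAt_id s).const_mul K).exp
  have h := graphHeatOp_nonneg_of_isLocalMaxOn_mul_sqrt e hf heq (by fun_prop)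
    (sub_nonneg.2 (Real.one_le_exp (by positivity))) hmax
  rw [graphHeatOp, heatOp_comp _ hφ (.of_forall fun s => (hexp s).sub_const 1)
    ((hexp _).const_mul K)] at h
  rw [← sub_nonneg]
  refine nonneg_of_mul_nonneg_right (h.trans_eq ?_) (by positivity : 0 < K * Real.exp (K * φ z))
  rw [graphHeatOp]
  ring

theorem spaceGrad_localizer (A B c d : ℝ) (x₀ : E) {f : E × ℝ → ℝ} {z : E × ℝ}
    (hf : DifferentiableAt ℝ f z) :
    spaceGrad (localizer A B c d x₀ f) z =
      -((2 * B) • (z.1 - x₀) + c • spaceGrad f z) := by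
  refine ext_inner_right ℝ fun a => ?_
  have h : HasFDerivAt (localizer A B c d x₀ f) _ z :=
    (((hasFDerivAt_snd.const_mul A).sub
      ((hasFDerivAt_fst.sub_const x₀).norm_sq.const_mul B)).sub
        (hf.hasFDerivAt.const_mul c)).add_const d
  rw [inner_spaceGrad, h.fderiv]
  simp only [map_sub, ContinuousLinearMap.sub_comp, sub_apply, smul_apply,
    ContinuousLinearMap.coe_snd', smul_eq_mul, mul_zero, ContinuousLinearMap.comp_apply,
    ContinuousLinearMap.coe_fst', coe_innerSL_apply, nsmul_eq_mul, Nat.cast_ofNat, zero_sub,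
    neg_add_rev, inner_add_left, inner_neg_left, inner_smul_left, Real.ringHom_apply,
    inner_spaceGrad, inner_sub_left]
  ring

theorem graphHeatOp_localizer_le (e : OrthonormalBasis ι ℝ E) {A B c d : ℝ} (hB : 0 ≤ B) (x₀ : E)
    {f : E × ℝ → ℝ} {z : E × ℝ} (hf : ContDiffAt ℝ 2 f z) (heq : graphHeatOp e f f z = 0) :
    graphHeatOp e f (localizer A B c d x₀ f) z ≤ A + 2 * B * Fintype.card ι := by
  have hsplit : localizer A B c d x₀ f = fun y =>
      A * y.2 + -B * ‖y.1 - x₀‖ ^ 2 + (-c * f y + d) := by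
    funext y
    rw [localizer]
    ring
  have ht : ContDiffAt ℝ 2 (fun y : E × ℝ => A * y.2) z := by fun_prop
  have hx : ContDiffAt ℝ 2 (fun y : E × ℝ => ‖y.1 - x₀‖ ^ 2) z :=
    (contDiffAt_fst.sub contDiffAt_const).norm_sq ℝ
  have hx' : ContDiffAt ℝ 2 (fun y : E × ℝ => -B * ‖y.1 - x₀‖ ^ 2) z := by fun_prop
  have hf' : ContDiffAt ℝ 2 (fun y : E × ℝ => -c * f y + d) z := by fun_prop
  unfold graphHeatOp at heq ⊢
  rw [hsplit, heatOp_add _ (ht.add hx') hf', heatOp_add _ ht hx', heatOp_affine_comp _ hf,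
    heatOp_const_mul _ hx, heatOp_const_mul _ contDiffAt_snd, heatOp_snd, heatOp_norm_sub_sq,
    heq]
  linarith [mul_le_mul_of_nonneg_left (sum_norm_sq_graphFrame_le e (spaceGrad f z)) hB]

theorem norm_spaceGrad_le_of_isLocalMaxOn (e : OrthonormalBasis ι ℝ E) {f : E × ℝ → ℝ}
    {z : E × ℝ} {x₀ : E} {A B c d K s : ℝ} (hf : ContDiffAt ℝ 3 f z)
    (heq : ∀ᶠ y in 𝓝 z, graphHeatOp e f f y = 0) (hB : 0 ≤ B) (hc : 0 < c) (hK : 0 < K)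
    (hs : 2 * B * ‖z.1 - x₀‖ ≤ s) (hKc : A + 2 * B * Fintype.card ι ≤ K * (c ^ 2 / 4))
    (hpos : 0 ≤ localizer A B c d x₀ f z)
    (hmax : IsLocalMaxOn (fun y => (Real.exp (K * localizer A B c d x₀ f y) - 1) *
      √(1 + ‖spaceGrad f y‖ ^ 2)) {y | y.2 ≤ z.2} z) :
    ‖spaceGrad f z‖ ≤ 1 + 2 * s / c := by
  by_contra! hlt
  have hf2 : ContDiffAt ℝ 2 f z := hf.of_le (by norm_num)
  have hφ : ContDiffAt ℝ 2 (localizer A B c d x₀ f) z :=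
    (((contDiffAt_const.mul contDiffAt_snd).sub (contDiffAt_const.mul
      ((contDiffAt_fst.sub contDiffAt_const).norm_sq ℝ))).sub (contDiffAt_const.mul hf2)).add
        contDiffAt_const
  have hupper := (mul_sum_sq_le_graphHeatOp e hf heq hφ hK hpos hmax).trans
    ((graphHeatOp_localizer_le e hB x₀ hf2 heq.self_of_nhds).trans hKc)
  have hlower : c ^ 2 / 4 < ∑ k, fderiv ℝ (localizer A B c d x₀ f) z
      (graphFrame e (spaceGrad f z) k, 0) ^ 2 := by
    rw [sum_fderiv_graphFrame_sq, spaceGrad_localizer A B c d x₀ (hf2.differentiableAt (by simp)),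
      norm_neg, inner_neg_right, neg_sq]
    refine sq_div_four_lt_of_lt_norm hc ?_ hlt
    rwa [norm_smul, Real.norm_of_nonneg (by positivity)]
  exact hupper.not_gt (mul_lt_mul_of_pos_left hlower hK)

end InteriorEstimate

section CylinderEstimate

variable {E : Type*} [NormedAddCommGroup E] [InnerProductSpace ℝ E] [ProperSpace E]
  {ι : Type*} [Fintype ι]

theorem le_exp_mul_of_exp_half_mul_le {K s v w S : ℝ} (hK : 2 ≤ K) (hs : s ≤ 1) (hw : 0 ≤ w)
    (hwS : w ≤ S) (h : (Real.exp (K / 2) - 1) * v ≤ (Real.exp (K * s) - 1) * w) :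
    v ≤ Real.exp K * S := by
  have hexp : Real.exp K = Real.exp (K / 2) ^ 2 := by rw [sq, ← Real.exp_add, add_halves]
  have hhalf : 2 ≤ Real.exp (K / 2) := by linarith [Real.add_one_le_exp (K / 2)]
  have hchain : (Real.exp (K / 2) - 1) * v ≤
      (Real.exp (K / 2) - 1) * ((Real.exp (K / 2) + 1) * S) := calc
    _ ≤ (Real.exp (K * s) - 1) * w := h
    _ ≤ (Real.exp K - 1) * S := by
      gcongr
      · exact sub_nonneg.2 (Real.one_le_exp (by linarith))
      · exact mul_le_of_le_one_right (by linarith) hs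
    _ = _ := by
      rw [hexp]
      ring
  refine (le_of_mul_le_mul_left hchain (by linarith)).trans ?_
  rw [hexp]
  gcongr
  · exact hw.trans hwS
  · nlinarith

theorem norm_spaceGrad_le_of_localizer (e : OrthonormalBasis ι ℝ E)
    {f : E × ℝ → ℝ} {x₀ : E} {ρ t₁ t₂ A B c d K : ℝ} (hρ : 0 ≤ ρ) (ht : t₁ ≤ t₂)
    (hf : ∀ z ∈ closedBall x₀ ρ ×ˢ Icc t₁ t₂, ContDiffAt ℝ 3 f z)
    (heq : ∀ z ∈ closedBall x₀ ρ ×ˢ Icc t₁ t₂, graphHeatOp e f f =ᶠ[𝓝 z] 0)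
    (hB : 0 ≤ B) (hc : 0 < c) (hK : 2 ≤ K)
    (hKc : A + 2 * B * Fintype.card ι ≤ K * (c ^ 2 / 4))
    (hcenter : localizer A B c d x₀ f (x₀, t₂) = 1 / 2)
    (hle : ∀ z ∈ closedBall x₀ ρ ×ˢ Icc t₁ t₂, localizer A B c d x₀ f z ≤ 1)
    (hbdry : ∀ z ∈ closedBall x₀ ρ ×ˢ Icc t₁ t₂, z ∉ ball x₀ ρ ×ˢ Ioc t₁ t₂ →
      localizer A B c d x₀ f z ≤ 0) :
    ‖spaceGrad f (x₀, t₂)‖ ≤ Real.exp K * (2 + 4 * B * ρ / c) := by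
  have hcont : ContinuousOn (fun y => (Real.exp (K * localizer A B c d x₀ f y) - 1) *
      √(1 + ‖spaceGrad f y‖ ^ 2)) (closedBall x₀ ρ ×ˢ Icc t₁ t₂) := by
    intro z hz
    have hfz : ContinuousAt f z := (hf z hz).continuousAt
    have hPz : ContinuousAt (spaceGrad f) z :=
      (hasFDerivAt_spaceGrad ((hf z hz).of_le (by norm_num))).continuousAt
    unfold localizer
    exact ContinuousAt.continuousWithinAt (by fun_prop)
  have hcenter_mem : (x₀, t₂) ∈ closedBall x₀ ρ ×ˢ Icc t₁ t₂ :=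
    ⟨mem_closedBall_self hρ, right_mem_Icc.2 ht⟩
  obtain ⟨z, hz, hmax⟩ :=
    ((isCompact_closedBall x₀ ρ).prod isCompact_Icc).exists_isMaxOn ⟨_, hcenter_mem⟩ hcont
  set φz := localizer A B c d x₀ f z
  have hexp_half : 2 ≤ Real.exp (K / 2) := by linarith [Real.add_one_le_exp (K / 2)]
  have hcompare : (Real.exp (K / 2) - 1) * √(1 + ‖spaceGrad f (x₀, t₂)‖ ^ 2) ≤
      (Real.exp (K * φz) - 1) * √(1 + ‖spaceGrad f z‖ ^ 2) := by
    simpa [hcenter, div_eq_mul_inv] using hmax hcenter_mem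
  have hφz : 0 < φz := by
    have hpos : 0 < (Real.exp (K * φz) - 1) * √(1 + ‖spaceGrad f z‖ ^ 2) :=
      (mul_pos (by linarith) (by positivity)).trans_le hcompare
    have hexp := pos_of_mul_pos_left hpos (Real.sqrt_nonneg _)
    exact pos_of_mul_pos_right (Real.one_lt_exp_iff.1 (sub_pos.1 hexp)) (by linarith)
  have hz_int : z ∈ ball x₀ ρ ×ˢ Ioc t₁ t₂ := by
    by_contra h
    exact (hbdry z hz h).not_gt hφz
  have hgrad : ‖spaceGrad f z‖ ≤ 1 + 2 * (2 * B * ρ) / c :=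
    norm_spaceGrad_le_of_isLocalMaxOn e (hf z hz) (heq z hz) hB hc (by linarith)
      (by gcongr; exact (mem_ball_iff_norm.1 hz_int.1).le) hKc hφz.le
      (isLocalMaxOn_past_of_isMaxOn hmax ⟨ball_subset_interior_closedBall hz_int.1, hz_int.2⟩)
  have hsqrt : √(1 + ‖spaceGrad f z‖ ^ 2) ≤ 2 + 4 * B * ρ / c := by
    refine (sqrt_one_add_norm_sq_le _).trans ?_
    linarith [show 2 * (2 * B * ρ) / c = 4 * B * ρ / c by ring]
  exact (Real.le_sqrt_of_sq_le (by linarith)).trans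
    (le_exp_mul_of_exp_half_mul_le hK (hle z hz) (Real.sqrt_nonneg _) hsqrt hcompare)

theorem norm_spaceGrad_le (e : OrthonormalBasis ι ℝ E)
    {f : E × ℝ → ℝ} {x₀ : E} {ρ t₁ t₂ m K : ℝ} (hρ : 0 < ρ) (ht : t₁ < t₂) (hm : 0 < m)
    (hf : ∀ z ∈ closedBall x₀ ρ ×ˢ Icc t₁ t₂, ContDiffAt ℝ 3 f z)
    (heq : ∀ z ∈ closedBall x₀ ρ ×ˢ Icc t₁ t₂, graphHeatOp e f f =ᶠ[𝓝 z] 0)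
    (hosc : ∀ z ∈ closedBall x₀ ρ ×ˢ Icc t₁ t₂, f (x₀, t₂) - m ≤ f z) (hK : 2 ≤ K)
    (hKm : 16 * m ^ 2 * ((t₂ - t₁)⁻¹ + 2 * (ρ ^ 2)⁻¹ * Fintype.card ι) ≤ K) :
    ‖spaceGrad f (x₀, t₂)‖ ≤ Real.exp K * (2 + 8 * m / ρ) := by
  have hτ : 0 < t₂ - t₁ := sub_pos.2 ht
  have hdrop (z) (hz : z ∈ closedBall x₀ ρ ×ˢ Icc t₁ t₂) :
      (f (x₀, t₂) - f z) / (2 * m) ≤ 1 / 2 := by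
    rw [div_le_iff₀ (by positivity)]
    linarith [hosc z hz]
  have htime (z) (hz : z ∈ closedBall x₀ ρ ×ˢ Icc t₁ t₂) : (z.2 - t₁) / (t₂ - t₁) ≤ 1 :=
    div_le_one_of_le₀ (by linarith [hz.2.2]) hτ.le
  have h := norm_spaceGrad_le_of_localizer e hρ.le ht.le hf heq (A := (t₂ - t₁)⁻¹)
    (B := (ρ ^ 2)⁻¹) (c := (2 * m)⁻¹)
    (d := (2 * m)⁻¹ * f (x₀, t₂) - (t₂ - t₁)⁻¹ * t₁ - 1 / 2) (K := K)
    (by positivity) (by positivity) hK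
    (by rw [← div_le_iff₀ (by positivity)]; refine le_of_eq_of_le ?_ hKm; field_simp; ring)
    (by rw [localizer_cylinder, sub_self, norm_zero, div_self hτ.ne']; ring)
    (fun z hz => by
      rw [localizer_cylinder]
      linarith [hdrop z hz, htime z hz, sq_nonneg (‖z.1 - x₀‖ / ρ)])
    (fun z hz hz' => by
      rw [localizer_cylinder]
      by_cases hx : z.1 ∈ ball x₀ ρ
      · have hz2 : z.2 = t₁ := le_antisymm (not_lt.1 fun h => hz' ⟨hx, h, hz.2.2⟩) hz.2.1
        rw [hz2, sub_self, zero_div]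
        linarith [hdrop z hz, sq_nonneg (‖z.1 - x₀‖ / ρ)]
      · have hx' : ‖z.1 - x₀‖ = ρ :=
          le_antisymm (mem_closedBall_iff_norm.1 hz.1) (not_lt.1 (mem_ball_iff_norm.not.1 hx))
        rw [hx', div_self hρ.ne']
        linarith [hdrop z hz, htime z hz])
  convert! h using 3
  field_simp
  ring

end CylinderEstimate

section SphereBarrier

variable {E : Type*} [NormedAddCommGroup E] [InnerProductSpace ℝ E] {ι : Type*} [Fintype ι]

theorem graphHeatOp_sphere [CompleteSpace E] (e : OrthonormalBasis ι ℝ E) {f : E × ℝ → ℝ}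
    {z : E × ℝ} (hf : ContDiffAt ℝ 2 f z) (heq : graphHeatOp e f f z = 0) (x₀ : E) (h : ℝ) :
    graphHeatOp e f
      (fun y => ‖y.1 - x₀‖ ^ 2 + (f y - h) ^ 2 + 2 * Fintype.card ι * y.2) z = 0 := by
  have hx : ContDiffAt ℝ 2 (fun y : E × ℝ => ‖y.1 - x₀‖ ^ 2) z :=
    (contDiffAt_fst.sub contDiffAt_const).norm_sq ℝ
  have hderiv (s : ℝ) : HasDerivAt (fun s => (s - h) ^ 2) (2 * (s - h)) s := by
    simpa using ((hasDerivAt_id s).sub_const h).fun_pow 2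
  have hderiv2 : HasDerivAt (fun s => 2 * (s - h)) 2 (f z) := by
    simpa using ((hasDerivAt_id (f z)).sub_const h).const_mul 2
  unfold graphHeatOp at heq ⊢
  rw [heatOp_add _ (by fun_prop) (by fun_prop), heatOp_add _ hx (by fun_prop), heatOp_norm_sub_sq,
    heatOp_comp _ hf (.of_forall hderiv) hderiv2, heq, heatOp_const_mul _ contDiffAt_snd,
    heatOp_snd, sum_norm_sq_graphFrame, sum_fderiv_graphFrame_sq, real_inner_self_eq_norm_sq]
  field_simp
  ring

variable [ProperSpace E]

theorem sq_le_of_sphere_barrier (e : OrthonormalBasis ι ℝ E) {f : E × ℝ → ℝ} {x₀ : E}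
    {R T h : ℝ} (hR : 0 < R) (hcont : ContinuousOn f (closedBall x₀ R ×ˢ Icc 0 T))
    (hf : ∀ z ∈ ball x₀ R ×ˢ Ioc 0 T, ContDiffAt ℝ 2 f z)
    (heq : ∀ z ∈ ball x₀ R ×ˢ Ioc 0 T, graphHeatOp e f f z = 0)
    (hinit : ∀ x ∈ closedBall x₀ R, R ^ 2 ≤ (f (x, 0) - h) ^ 2) {x : E} {t : ℝ}
    (hx : x ∈ closedBall x₀ R) (ht : t ∈ Icc 0 T) :
    R ^ 2 ≤ ‖x - x₀‖ ^ 2 + (f (x, t) - h) ^ 2 + 2 * Fintype.card ι * t := by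
  refine le_of_heatOp_nonneg (isCompact_closedBall x₀ R) (m := R ^ 2) (z := (x, t))
    (b := fun z => graphFrame e (spaceGrad f z))
    (g := fun y => ‖y.1 - x₀‖ ^ 2 + (f y - h) ^ 2 + 2 * Fintype.card ι * y.2)
    (by fun_prop)
    (fun z hz => by
      rw [interior_closedBall _ hR.ne'] at hz
      have hx : ContDiffAt ℝ 2 (fun y : E × ℝ => ‖y.1 - x₀‖ ^ 2) z :=
        (contDiffAt_fst.sub contDiffAt_const).norm_sq ℝ
      have hfz := hf z hz
      fun_prop)
    (fun z hz => by
      rw [interior_closedBall _ hR.ne'] at hz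
      exact (graphHeatOp_sphere e (hf z hz) (heq z hz) x₀ h).ge)
    (fun x hx => by
      have := hinit x hx
      simp only [mul_zero, add_zero]
      exact this.trans (le_add_of_nonneg_left (sq_nonneg _)))
    (fun x hx t ht => by
      rw [interior_closedBall _ hR.ne', closedBall_sdiff_ball, mem_sphere_iff_norm] at hx
      rw [hx, add_assoc]
      have := ht.1
      exact le_add_of_nonneg_right (by positivity))
    ⟨hx, ht⟩

theorem abs_lt_of_sphere_barrier (e : OrthonormalBasis ι ℝ E) {f : E × ℝ → ℝ} {x₀ : E}
    {R T M : ℝ} (hR : 0 < R) (hcont : ContinuousOn f (closedBall x₀ R ×ˢ Icc 0 T))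
    (hf : ∀ z ∈ ball x₀ R ×ˢ Ioc 0 T, ContDiffAt ℝ 2 f z)
    (heq : ∀ z ∈ ball x₀ R ×ˢ Ioc 0 T, graphHeatOp e f f z = 0)
    (hinit : ∀ x ∈ closedBall x₀ R, |f (x, 0)| ≤ M) {x : E} {t : ℝ}
    (ht : t ∈ Icc 0 T) (hxt : ‖x - x₀‖ ^ 2 + 2 * Fintype.card ι * t < R ^ 2) :
    |f (x, t)| < M + R := by
  have ht0 := ht.1
  have hx : x ∈ closedBall x₀ R := by
    refine mem_closedBall_iff_norm.2
      ((pow_le_pow_iff_left₀ (norm_nonneg _) hR.le two_ne_zero).1 (le_trans ?_ hxt.le))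
    exact le_add_of_nonneg_right (by positivity)
  have hcontx : ContinuousOn (fun s => |f (x, s)|) (Icc 0 t) :=
    (hcont.comp (by fun_prop) fun s hs => ⟨hx, hs.1, hs.2.trans ht.2⟩).abs
  by_contra! hle
  -- At a time when `|f (x, ·)|` reaches the height `M + R`, compare with the shrinking sphere that
  -- started with radius `R` around that point of the graph, away from the initial graph.
  obtain ⟨s, hs, hfs⟩ := intermediate_value_Icc ht.1 hcontx
    ⟨(hinit x hx).trans (le_add_of_nonneg_right hR.le), hle⟩
  have hbarrier := sq_le_of_sphere_barrier e (h := f (x, s)) hR hcont hf heq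
    (fun y hy => by
      rw [← sq_abs (f (y, 0) - f (x, s)), abs_sub_comm]
      gcongr
      have := abs_sub_abs_le_abs_sub (f (x, s)) (f (y, 0))
      linarith [hinit y hy])
    hx ⟨hs.1, hs.2.trans ht.2⟩
  rw [sub_self, zero_pow two_ne_zero, add_zero] at hbarrier
  exact (hbarrier.trans (by gcongr; exact hs.2)).not_gt hxt

end SphereBarrier

section GraphEquation

theorem hasFDerivAt_inv_sqrt_smul {V E : Type*} [NormedAddCommGroup V] [NormedSpace ℝ V]
    [NormedAddCommGroup E] [InnerProductSpace ℝ E] {P : V → E} {P' : V →L[ℝ] E} {x : V}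
    (hP : HasFDerivAt P P' x) :
    HasFDerivAt (fun y => (√(1 + ‖P y‖ ^ 2))⁻¹ • P y)
      ((√(1 + ‖P x‖ ^ 2))⁻¹ • P' -
        (√(1 + ‖P x‖ ^ 2))⁻¹ ^ 3 • ((innerSL ℝ (P x)).comp P').smulRight (P x)) x := by
  convert! ((hasDerivAt_inv_sqrt_one_add (by positivity)).comp_hasFDerivAt x hP.norm_sq).fun_smul
    hP using 1
  ext a
  simp only [inv_pow, sub_apply, smul_apply, ContinuousLinearMap.smulRight_apply,
    ContinuousLinearMap.comp_apply, coe_innerSL_apply, Function.comp_apply, neg_smul, add_apply,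
    neg_apply, nsmul_eq_mul, Nat.cast_ofNat, smul_eq_mul]
  module

variable {n : ℕ}

theorem mul_euclideanDiv_inv_sqrt_smul
    {P : EuclideanSpace ℝ (Fin n) → EuclideanSpace ℝ (Fin n)}
    {P' : EuclideanSpace ℝ (Fin n) →L[ℝ] EuclideanSpace ℝ (Fin n)} {x : EuclideanSpace ℝ (Fin n)}
    (hP : HasFDerivAt P P' x) :
    √(1 + ‖P x‖ ^ 2) * euclideanDiv (fun y => (√(1 + ‖P y‖ ^ 2))⁻¹ • P y) x =
      ∑ i, inner ℝ (P' (EuclideanSpace.basisFun (Fin n) ℝ i))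
          (EuclideanSpace.basisFun (Fin n) ℝ i) -
        (1 + ‖P x‖ ^ 2)⁻¹ * inner ℝ (P' (P x)) (P x) := by
  have hv : (1 + ‖P x‖ ^ 2)⁻¹ = (√(1 + ‖P x‖ ^ 2))⁻¹ ^ 2 := by
    rw [inv_pow, Real.sq_sqrt (by positivity)]
  have htrace : inner ℝ (P' (P x)) (P x) =
      ∑ i, inner ℝ (P x) (P' (EuclideanSpace.basisFun (Fin n) ℝ i)) * P x i := by
    rw [real_inner_comm]
    simpa [inner_sum, inner_smul_right, mul_comm] using
      (congrArg (fun v => inner ℝ (P x) (P' v))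
        ((EuclideanSpace.basisFun (Fin n) ℝ).sum_repr (P x))).symm
  rw [euclideanDiv, (hasFDerivAt_inv_sqrt_smul hP).fderiv, htrace, hv, Finset.mul_sum,
    Finset.mul_sum, ← Finset.sum_sub_distrib]
  refine Finset.sum_congr rfl fun i _ => ?_
  simp only [inv_pow, sub_apply, smul_apply, ContinuousLinearMap.smulRight_apply,
    ContinuousLinearMap.comp_apply, coe_innerSL_apply, PiLp.sub_apply, PiLp.smul_apply, smul_eq_mul,
    EuclideanSpace.basisFun_apply, EuclideanSpace.inner_single_right, Real.ringHom_apply, one_mul]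
  field_simp

variable {f : EuclideanSpace ℝ (Fin n) × ℝ → ℝ} {x : EuclideanSpace ℝ (Fin n)} {t : ℝ}

theorem gradient_slice (hf : DifferentiableAt ℝ f (x, t)) :
    gradient (fun y => f (y, t)) x = spaceGrad f (x, t) := by
  refine ext_inner_right ℝ fun a => ?_
  have h : HasFDerivAt (fun y => f (y, t)) _ x :=
    hf.hasFDerivAt.comp x (hasFDerivAt_prodMk_left x t)
  rw [inner_gradient_left, inner_spaceGrad, h.fderiv]
  simp

theorem deriv_slice (hf : DifferentiableAt ℝ f (x, t)) :
    deriv (fun s => f (x, s)) t = fderiv ℝ f (x, t) (0, 1) :=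
  (hf.hasFDerivAt.comp_hasDerivAt t ((hasDerivAt_const t x).prodMk (hasDerivAt_id t))).deriv

theorem graphMeanCurvatureOp_slice (hf : ContDiffAt ℝ 2 f (x, t)) :
    graphMeanCurvatureOp (fun y => f (y, t)) x =
      ∑ i, fderiv ℝ (fderiv ℝ f) (x, t) (EuclideanSpace.basisFun (Fin n) ℝ i, 0)
        (EuclideanSpace.basisFun (Fin n) ℝ i, 0) -
      (1 + ‖spaceGrad f (x, t)‖ ^ 2)⁻¹ *
        fderiv ℝ (fderiv ℝ f) (x, t) (spaceGrad f (x, t), 0) (spaceGrad f (x, t), 0) := by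
  have hslice : (fun y => gradient (fun y => f (y, t)) y) =ᶠ[𝓝 x] fun y => spaceGrad f (y, t) := by
    have hline : Tendsto (fun y => (y, t)) (𝓝 x) (𝓝 (x, t)) := (Continuous.prodMk_left t).tendsto x
    filter_upwards [hline.eventually (hf.eventually (by simp))] with y hy
    exact gradient_slice (hy.differentiableAt (by simp))
  have hP : HasFDerivAt (fun y => gradient (fun y => f (y, t)) y) _ x :=
    ((hasFDerivAt_spaceGrad hf).comp (f := fun y => (y, t)) x
      (hasFDerivAt_prodMk_left x t)).congr_of_eventuallyEq hslice
  rw [graphMeanCurvatureOp, mul_euclideanDiv_inv_sqrt_smul hP,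
    gradient_slice (hf.differentiableAt (by simp))]
  simp [spatialRiesz]

theorem graphHeatOp_eq_deriv_sub_graphMeanCurvatureOp (hf : ContDiffAt ℝ 2 f (x, t)) :
    graphHeatOp (EuclideanSpace.basisFun (Fin n) ℝ) f f (x, t) =
      deriv (fun s => f (x, s)) t - graphMeanCurvatureOp (fun y => f (y, t)) x := by
  rw [graphHeatOp_eq, graphMeanCurvatureOp_slice hf, deriv_slice (hf.differentiableAt (by simp))]
  ring

namespace GraphFlowsByMeanCurvature

variable {U : Set (EuclideanSpace ℝ (Fin n))} {T : ℝ} {u : EuclideanSpace ℝ (Fin n) → ℝ → ℝ}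
  {z : EuclideanSpace ℝ (Fin n) × ℝ}

theorem contDiffAt (hu : GraphFlowsByMeanCurvature U T u) (hU : IsOpen U)
    (hz : z ∈ U ×ˢ Ioo 0 T) : ContDiffAt ℝ ∞ (fun y => u y.1 y.2) z :=
  hu.smooth.contDiffAt ((hU.prod isOpen_Ioo).mem_nhds hz)

theorem graphHeatOp_eq_zero (hu : GraphFlowsByMeanCurvature U T u) (hU : IsOpen U)
    (hz : z ∈ U ×ˢ Ioo 0 T) :
    graphHeatOp (EuclideanSpace.basisFun (Fin n) ℝ) (fun y => u y.1 y.2) (fun y => u y.1 y.2) z =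
      0 := by
  rw [graphHeatOp_eq_deriv_sub_graphMeanCurvatureOp ((hu.contDiffAt hU hz).of_le ENat.LEInfty.out),
    hu.equation z.1 hz.1 z.2 hz.2, sub_self]

end GraphFlowsByMeanCurvature

end GraphEquation

section GradientBound

namespace GraphFlowsByMeanCurvature

variable {n : ℕ} {U : Set (EuclideanSpace ℝ (Fin n))} {r M T : ℝ}
  {u : EuclideanSpace ℝ (Fin n) → ℝ → ℝ}

theorem norm_gradient_le_of_oscillation (hu : GraphFlowsByMeanCurvature U T u) (hU : IsOpen U)
    {x₀ : EuclideanSpace ℝ (Fin n)} {ρ t m K : ℝ} (hρ : 0 < ρ) (hball : closedBall x₀ ρ ⊆ U)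
    (ht : 0 < t) (htT : t < T) (hm : 0 < m)
    (hosc : ∀ z ∈ closedBall x₀ ρ ×ˢ Icc (t / 2) t, u x₀ t - m ≤ u z.1 z.2) (hK : 2 ≤ K)
    (hKm : 32 * m ^ 2 * (t⁻¹ + n * (ρ ^ 2)⁻¹) ≤ K) :
    ‖gradient (fun x => u x t) x₀‖ ≤ Real.exp K * (2 + 8 * m / ρ) := by
  have hsub : closedBall x₀ ρ ×ˢ Icc (t / 2) t ⊆ U ×ˢ Ioo 0 T :=
    prod_mono hball fun s hs => ⟨by linarith [hs.1], by linarith [hs.2]⟩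
  rw [gradient_slice (f := fun y => u y.1 y.2) ((hu.contDiffAt hU
    (hsub ⟨mem_closedBall_self hρ.le, by linarith, le_rfl⟩)).differentiableAt (by simp))]
  refine norm_spaceGrad_le (EuclideanSpace.basisFun (Fin n) ℝ) hρ (by linarith) hm
    (fun z hz => (hu.contDiffAt hU (hsub hz)).of_le ENat.LEInfty.out)
    (fun z hz => ?_) hosc hK (le_of_eq_of_le ?_ hKm)
  · filter_upwards [(hU.prod isOpen_Ioo).mem_nhds (hsub hz)] with y hy
    exact hu.graphHeatOp_eq_zero hU hy
  · rw [Fintype.card_fin]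
    field_simp
    ring

theorem abs_lt_add (hu : GraphFlowsByMeanCurvature (ball 0 (√(2 * n + 1) * r)) (r ^ 2) u)
    (hn : 1 ≤ n) (hr : 0 < r) (hM : ∀ x ∈ ball 0 (√(2 * n + 1) * r), |u x 0| ≤ M)
    {z : EuclideanSpace ℝ (Fin n) × ℝ} (hz : z ∈ closedBall 0 r ×ˢ Icc 0 (r ^ 2 / (4 * n))) :
    |u z.1 z.2| < M + 3 / 2 * r := by
  have hn' : (1 : ℝ) ≤ n := mod_cast hn
  have ht : r ^ 2 / (4 * n) < r ^ 2 := div_lt_self (by positivity) (by linarith)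
  have hR : 3 / 2 * r < √(2 * n + 1) * r := by
    gcongr
    exact Real.lt_sqrt_of_sq_lt (by linarith)
  have hball : closedBall (0 : EuclideanSpace ℝ (Fin n)) (3 / 2 * r) ⊆
      ball 0 (√(2 * n + 1) * r) := closedBall_subset_ball hR
  have hsub : ball (0 : EuclideanSpace ℝ (Fin n)) (3 / 2 * r) ×ˢ Ioc 0 (r ^ 2 / (4 * n)) ⊆
      ball 0 (√(2 * n + 1) * r) ×ˢ Ioo 0 (r ^ 2) :=
    prod_mono (ball_subset_closedBall.trans hball) (Ioc_subset_Ioo_right ht)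
  refine abs_lt_of_sphere_barrier (EuclideanSpace.basisFun (Fin n) ℝ) (by positivity)
    (hu.continuousOn.mono (prod_mono hball (Icc_subset_Icc_right ht.le)))
    (fun y hy => (hu.contDiffAt isOpen_ball (hsub hy)).of_le ENat.LEInfty.out)
    (fun y hy => hu.graphHeatOp_eq_zero isOpen_ball (hsub hy))
    (fun x hx => hM x (hball hx)) hz.2 ?_
  have hx : ‖z.1 - 0‖ ^ 2 ≤ r ^ 2 := by
    gcongr
    exact mem_closedBall_iff_norm.1 hz.1
  have htime : 2 * n * z.2 ≤ r ^ 2 / 2 := by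
    have := (le_div_iff₀ (by positivity)).1 hz.2.2
    linarith
  rw [Fintype.card_fin]
  nlinarith

theorem norm_gradient_le (hu : GraphFlowsByMeanCurvature (ball 0 (√(2 * n + 1) * r)) (r ^ 2) u)
    (hn : 1 ≤ n) (hr : 0 < r) (hM : ∀ x ∈ ball 0 (√(2 * n + 1) * r), |u x 0| ≤ M) :
    ‖gradient (fun x => u x (r ^ 2 / (4 * n))) 0‖ ≤
      Real.exp (1440 * n * (1 + r⁻¹ * M) ^ 2) * (26 * (1 + r⁻¹ * M)) := by
  have hn' : (1 : ℝ) ≤ n := mod_cast hn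
  have hM0 : 0 ≤ M := (abs_nonneg _).trans (hM 0 (mem_ball_self (by positivity)))
  set X := 1 + r⁻¹ * M with hX
  have hX1 : 1 ≤ X := le_add_of_nonneg_right (by positivity)
  have hrX : r * X = r + M := by rw [hX]; field_simp
  set t := r ^ 2 / (4 * n) with ht
  have ht0 : 0 < t := by positivity
  have hball : closedBall (0 : EuclideanSpace ℝ (Fin n)) r ⊆ ball 0 (√(2 * n + 1) * r) :=
    closedBall_subset_ball (lt_mul_of_one_lt_left hr (Real.lt_sqrt_of_sq_lt (by linarith)))
  have hosc (z) (hz : z ∈ closedBall 0 r ×ˢ Icc (t / 2) t) :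
      u 0 t - 3 * (r * X) ≤ u z.1 z.2 := by
    have hz' := abs_lt.1 (hu.abs_lt_add hn hr hM ⟨hz.1, by linarith [hz.2.1], hz.2.2⟩)
    have h0 := abs_lt.1 (hu.abs_lt_add hn hr hM (z := (0, t))
      ⟨mem_closedBall_self hr.le, ht0.le, le_rfl⟩)
    linarith
  refine (hu.norm_gradient_le_of_oscillation isOpen_ball hr hball ht0
    (div_lt_self (by positivity) (by linarith)) (by positivity) hosc
    (K := 1440 * n * X ^ 2) (by nlinarith [one_le_pow₀ hX1 (n := 2)]) ?_).trans ?_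
  · refine le_of_eq ?_
    rw [ht]
    field_simp
    norm_num
  · gcongr
    calc 2 + 8 * (3 * (r * X)) / r = 2 + 24 * X := by field_simp; ring
      _ ≤ 26 * X := by linarith

end GraphFlowsByMeanCurvature

end GradientBound

theorem theorem1p1 (n : ℕ) (hn : 1 ≤ n) :
    ∃ C : ℝ, ∀ (r : ℝ) (_ : 0 < r) (u : EuclideanSpace ℝ (Fin n) → ℝ → ℝ),
      GraphFlowsByMeanCurvature
        (Metric.ball (0 : EuclideanSpace ℝ (Fin n)) (Real.sqrt (2 * (n : ℝ) + 1) * r)) (r ^ 2) u →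
      BddAbove ((fun x => |u x 0|) ''
        Metric.ball (0 : EuclideanSpace ℝ (Fin n)) (Real.sqrt (2 * (n : ℝ) + 1) * r)) →
      Real.log ‖gradient (fun x => u x (r ^ 2 / (4 * (n : ℝ)))) 0‖ ≤
        C * (1 + r⁻¹ * supNormOn
          (Metric.ball (0 : EuclideanSpace ℝ (Fin n)) (Real.sqrt (2 * (n : ℝ) + 1) * r))
          (fun x => u x 0)) ^ 2 := by
  refine ⟨1440 * n + 26, fun r hr u hu hbdd => ?_⟩
  set M := supNormOn (ball (0 : EuclideanSpace ℝ (Fin n)) (√(2 * n + 1) * r)) fun x => u x 0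
  have hM : ∀ x ∈ ball 0 (√(2 * n + 1) * r), |u x 0| ≤ M := fun x hx => le_csSup hbdd ⟨x, hx, rfl⟩
  have hM0 : 0 ≤ M := (abs_nonneg _).trans (hM 0 (mem_ball_self (by positivity)))
  have hbound := hu.norm_gradient_le hn hr hM
  set X := 1 + r⁻¹ * M
  have hX : 1 ≤ X := le_add_of_nonneg_right (by positivity)
  rcases (norm_nonneg (gradient (fun x => u x (r ^ 2 / (4 * n))) 0)).eq_or_lt with h0 | hpos
  · rw [← h0, Real.log_zero]
    positivity
  calc
    Real.log ‖gradient (fun x => u x (r ^ 2 / (4 * n))) 0‖ ≤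
        Real.log (Real.exp (1440 * n * X ^ 2) * (26 * X)) := Real.log_le_log hpos hbound
    _ = 1440 * n * X ^ 2 + Real.log (26 * X) := by
      rw [Real.log_mul (Real.exp_ne_zero _) (by positivity), Real.log_exp]
    _ ≤ 1440 * n * X ^ 2 + 26 * X ^ 2 := by
      gcongr
      exact (Real.log_le_self (by positivity)).trans (by gcongr; exact le_self_pow₀ hX two_ne_zero)
    _ = (1440 * n + 26) * X ^ 2 := by ring
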